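/- Let $F$ be a connected oriented punctured surface and let $\Delta$ be an ideal triangulation of $F$, that is, a finite collection of disjoint arcs running between punctures which decompose $F$ into triangles with their vertices at the punctures. An integral measure on $\Delta$ is a function $\mu:\Delta\to\mathbb Z$. It satisfies the tropical triangle inequalities TT if for every complementary triangle with frontier edges $a,b,c$ (listed with multiplicity) $$\mu(a)\le\max\{\mu(b),\mu(c)\},\qquad \mu(b)\le\max\{\mu(a),\mu(c)\},\qquad \mu(c)\le\max\{\mu(a),\mu(b)\}.$$ A simple closed curve is considered up to isotopy. The measure $\mu$ corresponds to the simple closed curve $\gamma$ if $\gamma$ is isotopic to a simple closed curve which meets each complementary triangle in finitely many disjoint arcs, each of them connecting two different sides of the triangle, and which crosses every edge $e\in\Delta$ exactly $\mu(e)$ times. (i) If an integral measure $\mu$ on $\Delta$ satisfies TT and corresponds to a simple closed curve, then $\mu(e)\le 3$ for every $e\in\Delta$. (ii) There are only finitely many isotopy classes of simple closed curves in $F$ that correspond to an integral measure on $\Delta$ satisfying TT. -/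

import Mathlib

open Topology

/-- The ideal triangle: the standard `2`-simplex, in barycentric coordinates, with its three
vertices removed. Its `i`-th side is `{x | x i = 0}`, an open arc running between the removed
vertices `i + 1` and `i + 2` (indices modulo `3`). -/
def idealTriangle : Set (Fin 3 → ℝ) := {x | x ∈ stdSimplex ℝ (Fin 3) ∧ ∀ i, x i < 1}

/-- An ideal triangulation of an (oriented, punctured) surface `F`: finitely many ideal triangles,
their sides glued together in pairs by orientation-reversing affine maps of the sides, with
quotient space `F`. The punctures of `F` are the missing vertices. -/
structure IdealTriangulation (F : Type*) [TopologicalSpace F] where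
  /-- the number of triangles -/
  n : ℕ
  /-- the pairing of the sides; `(t, i)` is the `i`-th side of the triangle `t` -/
  glue : Fin n × Fin 3 → Fin n × Fin 3
  glue_glue : Function.Involutive glue
  glue_ne : ∀ s, glue s ≠ s
  /-- the characteristic maps of the triangles -/
  chart : Fin n × idealTriangle → F
  isQuotientMap_chart : IsQuotientMap chart
  /-- exactly the points matched by the pairing of the sides are identified -/
  chart_eq_iff : ∀ p q, chart p = chart q ↔ p = q ∨
    ∃ i j, glue (p.1, i) = (q.1, j) ∧ p.2.1 i = 0 ∧ q.2.1 j = 0 ∧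
      q.2.1 (j + 1) = p.2.1 (i + 2) ∧ q.2.1 (j + 2) = p.2.1 (i + 1)

section Curves

variable (F : Type*) [TopologicalSpace F]

/-- Simple closed curves in `F` (unparametrized and unoriented): embedded circles. -/
def SimpleClosedCurve : Type _ := {C : Set F // ∃ f : Circle → F, IsEmbedding f ∧ Set.range f = C}

variable {F}

/-- Isotopy of simple closed curves: a continuous one-parameter family of embedded circles
from one curve to the other. -/
def Isotopic (C C' : SimpleClosedCurve F) : Prop :=
  ∃ H : unitInterval × Circle → F, Continuous H ∧ (∀ t, IsEmbedding fun z => H (t, z)) ∧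
    (Set.range fun z => H (0, z)) = C.1 ∧ (Set.range fun z => H (1, z)) = C'.1

theorem Isotopic.refl (C : SimpleClosedCurve F) : Isotopic C C := by
  obtain ⟨C, f, hf, rfl⟩ := C
  exact ⟨fun p => f p.2, hf.continuous.comp continuous_snd, fun _ => hf, rfl, rfl⟩

theorem Isotopic.symm {C C' : SimpleClosedCurve F} (h : Isotopic C C') : Isotopic C' C := by
  obtain ⟨H, hc, he, h0, h1⟩ := h
  refine ⟨fun p => H (unitInterval.symm p.1, p.2), by fun_prop, fun t => he (unitInterval.symm t), ?_, ?_⟩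
  · simpa using h1
  · simpa using h0

theorem Isotopic.trans {C C' C'' : SimpleClosedCurve F} (h : Isotopic C C')
    (h' : Isotopic C' C'') : Isotopic C C'' := by
  obtain ⟨H, hc, he, h0, h1⟩ := h
  obtain ⟨K, kc, ke, k0, k1⟩ := h'
  -- reparametrize the second isotopy so that it starts where the first one ends
  let φ : Circle ≃ₜ Circle := (he 1).toHomeomorph.trans
    ((Homeomorph.setCongr (h1.trans k0.symm)).trans (ke 0).toHomeomorph.symm)
  have hφ : ∀ z, K (0, φ z) = H (1, z) := by
    intro z
    have := congrArg Subtype.val ((ke 0).toHomeomorph.apply_symm_apply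
      (Homeomorph.setCongr (h1.trans k0.symm) ((he 1).toHomeomorph z)))
    exact this
  let f₀ : C(Circle, F) := ⟨fun z => H (0, z), by fun_prop⟩
  let f₁ : C(Circle, F) := ⟨fun z => H (1, z), by fun_prop⟩
  let f₂ : C(Circle, F) := ⟨fun z => K (1, φ z), by fun_prop⟩
  let A : ContinuousMap.Homotopy f₀ f₁ :=
    { toFun := H, continuous_toFun := hc, map_zero_left := fun _ => rfl
      map_one_left := fun _ => rfl }
  let B : ContinuousMap.Homotopy f₁ f₂ :=
    { toFun := fun p => K (p.1, φ p.2), continuous_toFun := by fun_prop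
      map_zero_left := fun z => hφ z, map_one_left := fun _ => rfl }
  have hA : ∀ p, A p = H p := fun _ => rfl
  have hB : ∀ p, B p = K (p.1, φ p.2) := fun _ => rfl
  refine ⟨A.trans B, (A.trans B).continuous, fun t => ?_, ?_, ?_⟩
  · by_cases ht : (t : ℝ) ≤ 1 / 2
    · simp only [ContinuousMap.Homotopy.trans_apply, ht, dif_pos, hA]
      exact he ⟨2 * t, (unitInterval.mul_pos_mem_iff zero_lt_two).2 ⟨t.2.1, ht⟩⟩
    · simp only [ContinuousMap.Homotopy.trans_apply, ht, dif_neg, not_false_eq_true, hB]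
      exact (ke ⟨2 * t - 1, unitInterval.two_mul_sub_one_mem_iff.2 ⟨(not_le.1 ht).le, t.2.2⟩⟩).comp
        φ.isEmbedding
  · rw [← h0]
    exact congrArg Set.range (funext fun z => (A.trans B).map_zero_left z)
  · rw [← k1, ← φ.surjective.range_comp fun z => K (1, z)]
    exact congrArg Set.range (funext fun z => (A.trans B).map_one_left z)

variable (F)

/-- The relation of isotopy on simple closed curves. -/
def isotopySetoid : Setoid (SimpleClosedCurve F) :=
  ⟨Isotopic, Isotopic.refl, Isotopic.symm, Isotopic.trans⟩

end Curves

/-- A chord of the ideal triangle: a straight segment joining two distinct sides. -/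
def IsChord (A : Set idealTriangle) : Prop :=
  ∃ (x y : idealTriangle) (i j : Fin 3), i ≠ j ∧ x.1 i = 0 ∧ y.1 j = 0 ∧
    A = {z | z.1 ∈ segment ℝ x.1 y.1}

namespace IdealTriangulation

variable {F : Type*} [TopologicalSpace F] (D : IdealTriangulation F)

/-- The arc in `F` that is the image of a given side of a triangle. -/
def arc (s : Fin D.n × Fin 3) : Set F := {p | ∃ x : idealTriangle, x.1 s.2 = 0 ∧ D.chart (s.1, x) = p}

/-- The edges of the triangulation: the arcs in `F` that are images of sides of triangles.
Both sides of a glued pair give the same edge. -/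
abbrev Edge : Type _ := Set.range D.arc

/-- The edge of the triangulation that carries a given side of a triangle. -/
def edge (s : Fin D.n × Fin 3) : D.Edge := ⟨D.arc s, s, rfl⟩

/-- The tropical triangle inequalities for a measure `μ` on the edges: in each triangle, each
side has measure at most the maximum of the measures of the other two sides. -/
def TropicalTriangle (μ : D.Edge → ℤ) : Prop :=
  ∀ t i, μ (D.edge (t, i)) ≤ max (μ (D.edge (t, i + 1))) (μ (D.edge (t, i + 2)))

/-- A subset of `F` is normal (carried by the dual freeway of the triangulation, and drawn
straight) if it meets each triangle in finitely many disjoint chords. -/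
def IsNormal (C : Set F) : Prop :=
  ∀ t, ∃ S : Set (Set idealTriangle), S.Finite ∧ (∀ A ∈ S, IsChord A) ∧ S.PairwiseDisjoint id ∧
    {x | D.chart (t, x) ∈ C} = ⋃₀ S

/-- The integral measure `μ` corresponds to the simple closed curve `C`: laying, in each triangle,
disjoint arcs around its corners so that each edge `e` is crossed `μ e` times in all yields a
single closed curve, and this curve is isotopic to `C`. -/
def Corresponds (μ : D.Edge → ℤ) (C : SimpleClosedCurve F) : Prop :=
  ∃ C' : SimpleClosedCurve F, Isotopic C C' ∧ D.IsNormal C'.1 ∧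
    ∀ e : D.Edge, μ e = ((C'.1 ∩ e.1).ncard : ℤ)

end IdealTriangulation

/-!
Straighten the curve and look at one triangle. If `x, y, z` are the numbers of chords around its
three vertices, then the sides are crossed `y + z`, `x + z`, `x + y` times, and the tropical
triangle inequalities say that the two smallest of `x, y, z` are equal. Consequently, a chord that
starts in an outermost crossing of its side (the first or the last one) also ends in an outermost
crossing: going around the vertex, the innermost chord is innermost on both sides, and a crossing is
farthest from the vertex on its side only if no chord goes around the other end of that side, in
which case all chords of the triangle are parallel (`IsChordSystem.isOutermost_iff`). Gluing
reverses the sides and so preserves outermost crossings. Therefore the chords between outermost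
crossings and the remaining chords form two disjoint closed sets; the curve is connected, so all its
crossings are outermost (`IsChordSystem.isOutermost_of_isPreconnected`), and there are at most two
of them on each edge, which is even better than the required bound.

For finiteness, record the number of crossings on each side and which crossings, numbered along the
sides, are joined by chords. With at most two crossings per side there are finitely many such
records. Two curves with the same record are isotopic (`isotopic_of_chordMap`): interpolate the
positions of the crossings linearly. The order of the crossings and the symmetry under gluing
persist, so the chords stay disjoint (`IsNoncrossing.congr`) and the identifications between their
points stay the same (`chordMap_eq_of_eq`); hence the moving chords form an embedded circle at all
times.
-/

/-! ### Points and chords of the ideal triangle -/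

/-- Positions on a side of the ideal triangle. The position of a point `x` of the `i`-th side is its
barycentric coordinate `x (i + 1)`, so that `0` and `1` stand for the removed vertices `i + 2` and
`i + 1`. -/
abbrev SidePosition : Type := Set.Ioo (0 : ℝ) 1

/-- The reversal of a side: the effect of a gluing map on positions. -/
def SidePosition.flip (r : SidePosition) : SidePosition :=
  ⟨1 - r, by linarith [r.2.2], by linarith [r.2.1]⟩

namespace idealTriangle

theorem fin_three_cases (i j : Fin 3) : j = i ∨ j = i + 1 ∨ j = i + 2 := by
  revert i j; decide

theorem add_one_add_one (i : Fin 3) : i + 1 + 1 = i + 2 := by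
  revert i; decide

theorem add_one_add_two (i : Fin 3) : i + 1 + 2 = i := by
  revert i; decide

theorem add_two_add_one (i : Fin 3) : i + 2 + 1 = i := by
  revert i; decide

theorem add_two_add_two (i : Fin 3) : i + 2 + 2 = i + 1 := by
  revert i; decide

theorem ext_at {x y : idealTriangle} (i : Fin 3) (h₀ : x.1 i = y.1 i)
    (h₁ : x.1 (i + 1) = y.1 (i + 1)) (h₂ : x.1 (i + 2) = y.1 (i + 2)) : x = y := by
  refine Subtype.ext (funext fun j => ?_)
  rcases fin_three_cases i j with rfl | rfl | rfl <;> assumption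

theorem sum_at (x : Fin 3 → ℝ) (i : Fin 3) : ∑ j, x j = x i + x (i + 1) + x (i + 2) := by
  rw [Fin.sum_univ_three]
  fin_cases i
  · rfl
  · change _ = x 1 + x 2 + x 0
    ring
  · change _ = x 2 + x 0 + x 1
    ring

theorem add_at (x : idealTriangle) (i : Fin 3) : x.1 i + x.1 (i + 1) + x.1 (i + 2) = 1 := by
  rw [← sum_at]; exact x.2.1.2

/-- The point of the `i`-th side in a given position. -/
def sidePt (i : Fin 3) (r : SidePosition) : idealTriangle :=
  ⟨fun j => if j = i then 0 else if j = i + 1 then r else 1 - r, by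
    have := r.2.1
    have := r.2.2
    refine ⟨⟨fun j => ?_, ?_⟩, fun j => ?_⟩
    · dsimp only; split_ifs <;> linarith
    · rw [sum_at _ i]; simp
    · dsimp only; split_ifs <;> linarith⟩

@[simp] theorem sidePt_zero (i r) : (sidePt i r).1 i = 0 := by simp [sidePt]
@[simp] theorem sidePt_one (i r) : (sidePt i r).1 (i + 1) = r := by simp [sidePt]
@[simp] theorem sidePt_two (i r) : (sidePt i r).1 (i + 2) = 1 - r := by simp [sidePt]

theorem sidePt_injective (i : Fin 3) : Function.Injective (sidePt i) := fun r r' h =>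
  Subtype.ext (by rw [← sidePt_one i r, h, sidePt_one])

theorem sidePt_eq_zero_iff {i j : Fin 3} {r : SidePosition} : (sidePt i r).1 j = 0 ↔ j = i := by
  have := r.2.1
  have := r.2.2
  refine ⟨fun h => ?_, fun h => by simp [h]⟩
  rcases fin_three_cases i j with rfl | rfl | rfl
  · rfl
  · rw [sidePt_one] at h; linarith
  · rw [sidePt_two] at h; linarith

theorem exists_eq_sidePt {i : Fin 3} {x : idealTriangle} (h : x.1 i = 0) :
    ∃ r, x = sidePt i r := by
  have h1 := add_at x i
  have h2 := x.2.2 (i + 2)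
  refine ⟨⟨x.1 (i + 1), by linarith, x.2.2 _⟩, ext_at i ?_ ?_ ?_⟩ <;> simp [h]
  linarith

/-- The point at time `u` of the chord that runs from the point in position `r` of the `i`-th side
to the point in position `r'` of the `(i + 1)`-st side, and thus cuts off the vertex `i + 2`. -/
def chordPt (i : Fin 3) (r r' : SidePosition) (u : unitInterval) : idealTriangle :=
  ⟨fun j => if j = i then u * (1 - r') else if j = i + 1 then (1 - u) * r else
      (1 - u) * (1 - r) + u * r', by
    obtain ⟨r, h1, h2⟩ := r
    obtain ⟨r', h3, h4⟩ := r'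
    obtain ⟨u, h5, h6⟩ := u
    refine ⟨⟨fun j => ?_, ?_⟩, fun j => ?_⟩
    · dsimp only; split_ifs
      · exact mul_nonneg h5 (by linarith)
      · exact mul_nonneg (by linarith) h1.le
      · exact add_nonneg (mul_nonneg (by linarith) (by linarith)) (mul_nonneg h5 h3.le)
    · rw [sum_at _ i]; simp; ring
    · dsimp only; split_ifs
      · nlinarith
      · nlinarith
      · have := convex_Ioo (0 : ℝ) 1 (x := 1 - r) ⟨by linarith, by linarith⟩ (y := r') ⟨h3, h4⟩
          (sub_nonneg.2 h6) h5 (by ring)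
        exact this.2⟩

section chordPt

variable (i : Fin 3) (r r' : SidePosition) (u : unitInterval)

@[simp] theorem chordPt_zero : (chordPt i r r' u).1 i = u * (1 - r') := by simp [chordPt]
@[simp] theorem chordPt_one : (chordPt i r r' u).1 (i + 1) = (1 - u) * r := by simp [chordPt]
@[simp] theorem chordPt_two : (chordPt i r r' u).1 (i + 2) = (1 - u) * (1 - r) + u * r' := by
  simp [chordPt]

theorem chordPt_start : chordPt i r r' 0 = sidePt i r := by
  apply ext_at i <;> simp

theorem sidePt_succ_zero : (sidePt (i + 1) r).1 i = 1 - r := by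
  have := sidePt_two (i + 1) r
  rwa [add_one_add_two] at this

theorem sidePt_succ_two : (sidePt (i + 1) r).1 (i + 2) = r := by
  have := sidePt_one (i + 1) r
  rwa [add_one_add_one] at this

theorem chordPt_end : chordPt i r r' 1 = sidePt (i + 1) r' := by
  apply ext_at i <;> simp [sidePt_succ_zero, sidePt_succ_two]

theorem continuous_chordPt :
    Continuous fun p : (SidePosition × SidePosition) × unitInterval =>
      chordPt i p.1.1 p.1.2 p.2 := by
  refine Continuous.subtype_mk (continuous_pi fun j => ?_) _
  rcases fin_three_cases i j with rfl | rfl | rfl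
  all_goals simp; fun_prop

end chordPt

variable {i j : Fin 3} {r r' s s' : SidePosition} {u v : unitInterval}

theorem chordPt_eq_zero (h : (chordPt i r r' u).1 j = 0) : u = 0 ∧ j = i ∨ u = 1 ∧ j = i + 1 := by
  obtain ⟨r, h1, h2⟩ := r
  obtain ⟨r', h3, h4⟩ := r'
  obtain ⟨u, h5, h6⟩ := u
  rcases fin_three_cases i j with rfl | rfl | rfl
  · refine Or.inl ⟨Subtype.ext ?_, rfl⟩
    simp only [chordPt_zero, mul_eq_zero] at h
    exact h.resolve_right (by linarith)
  · refine Or.inr ⟨Subtype.ext ?_, rfl⟩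
    simp only [chordPt_one, mul_eq_zero] at h
    have := h.resolve_right (by linarith)
    change u = 1
    linarith
  · exfalso
    simp only [chordPt_two] at h
    have := convex_Ioo (0 : ℝ) 1 (x := 1 - r) ⟨by linarith, by linarith⟩ (y := r') ⟨h3, h4⟩
      (sub_nonneg.2 h6) h5 (by ring)
    exact this.1.ne' h

theorem chordPt_injective (i : Fin 3) (r r' : SidePosition) :
    Function.Injective (chordPt i r r') := by
  intro u v h
  have h0 := congrArg (fun x => x.1 i) h
  simp only [chordPt_zero] at h0
  exact Subtype.ext (mul_right_cancel₀ (by linarith [r'.2.2]) h0)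

/-- Parallel chords around the same vertex are disjoint. -/
theorem chordPt_ne_of_lt (h : r < s) (h' : s' < r') : chordPt i r r' u ≠ chordPt i s s' v := by
  intro e
  have e0 := congrArg (fun x => x.1 i) e
  have e1 := congrArg (fun x => x.1 (i + 1)) e
  obtain ⟨r, h1, h2⟩ := r
  obtain ⟨r', h3, h4⟩ := r'
  obtain ⟨s, h7, h8⟩ := s
  obtain ⟨s', h9, h10⟩ := s'
  obtain ⟨u, h5, h6⟩ := u
  obtain ⟨v, h11, h12⟩ := v
  simp only [chordPt_zero, chordPt_one] at e0 e1
  replace h : r < s := h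
  replace h' : s' < r' := h'
  -- the first coordinate forces `v ≤ u`, the second `u ≤ v`, and then both positions agree
  have a : v ≤ u := by
    by_contra hc
    nlinarith [mul_le_mul_of_nonneg_left h'.le h5,
      mul_pos (sub_pos.2 (not_le.1 hc)) (sub_pos.2 h10)]
  have b : u ≤ v := by
    by_contra hc
    nlinarith [mul_le_mul_of_nonneg_left h.le (sub_nonneg.2 h6),
      mul_pos (sub_pos.2 (not_le.1 hc)) h7]
  obtain rfl := le_antisymm a b
  have c0 : v * (r' - s') = 0 := by linarith
  have c1 : (1 - v) * (s - r) = 0 := by linarith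
  rcases mul_eq_zero.1 c0 with c | c
  · subst c; linarith
  · linarith

/-- Chords around different vertices are disjoint if they meet the common side in the right
order. -/
theorem chordPt_ne_of_lt_succ (h : s < r') : chordPt i r r' u ≠ chordPt (i + 1) s s' v := by
  intro e
  have e0 := congrArg (fun x => x.1 (i + 1 + 1)) e
  have e1 := congrArg (fun x => x.1 (i + 1 + 2)) e
  simp only [chordPt_one, chordPt_two] at e0 e1
  rw [add_one_add_one, chordPt_two] at e0
  rw [add_one_add_two, chordPt_zero] at e1
  obtain ⟨r, h1, h2⟩ := r
  obtain ⟨r', h3, h4⟩ := r'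
  obtain ⟨s, h7, h8⟩ := s
  obtain ⟨s', h9, h10⟩ := s'
  obtain ⟨u, h5, h6⟩ := u
  obtain ⟨v, h11, h12⟩ := v
  replace h : s < r' := h
  simp only at e0 e1
  -- the first chord lies where `r' * (x (i + 2) + x i) ≤ x (i + 2)`, the second one where
  -- `x (i + 2) ≤ s * (x (i + 2) + x i)`
  have a : r' * ((1 - u) * (1 - r) + u * r' + u * (1 - r')) ≤ (1 - u) * (1 - r) + u * r' := by
    nlinarith [mul_nonneg (mul_nonneg (sub_nonneg.2 h6) (sub_nonneg.2 h2.le)) (sub_nonneg.2 h4.le)]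
  have b : (1 - v) * s ≤ s * ((1 - v) * s + ((1 - v) * (1 - s) + v * s')) := by
    nlinarith [mul_nonneg (mul_nonneg h11 h9.le) h7.le]
  have c : 0 < (1 - u) * (1 - r) + u * r' + u * (1 - r') := by nlinarith
  rw [e1, e0] at a c
  nlinarith

/-- Chords around the same vertex that are not strictly nested intersect; the common point solves a
linear system. -/
theorem exists_chordPt_eq (h : r ≤ s) (h' : r' ≤ s') :
    ∃ u v, chordPt i r r' u = chordPt i s s' v := by
  suffices H : ∃ u v : unitInterval, (u : ℝ) * (1 - r') = v * (1 - s') ∧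
      (1 - (u : ℝ)) * r = (1 - v) * s by
    obtain ⟨u, v, h0, h1⟩ := H
    refine ⟨u, v, ext_at i (by simpa using h0) (by simpa using h1) ?_⟩
    simp only [chordPt_two]
    linarith
  obtain ⟨r, h1, h2⟩ := r
  obtain ⟨r', h3, h4⟩ := r'
  obtain ⟨s, h7, h8⟩ := s
  obtain ⟨s', h9, h10⟩ := s'
  replace h : r ≤ s := h
  replace h' : r' ≤ s' := h'
  simp only
  have p1 : 0 ≤ (s - r) * (1 - s') := mul_nonneg (by linarith) (by linarith)
  have p2 : 0 ≤ (s - r) * (1 - r') := mul_nonneg (by linarith) (by linarith)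
  have p3 : 0 ≤ (s' - r') * s := mul_nonneg (by linarith) (by linarith)
  have p4 : 0 ≤ (s' - r') * r := mul_nonneg (by linarith) (by linarith)
  have hd : 0 ≤ (1 - r') * s - (1 - s') * r := by nlinarith
  rcases hd.eq_or_lt with hd | hd
  · have : (s - r) * (1 - s') = 0 := by nlinarith
    obtain rfl : s = r := by
      rcases mul_eq_zero.1 this with c | c <;> linarith
    have : (s' - r') * s = 0 := by nlinarith
    obtain rfl : s' = r' := by
      rcases mul_eq_zero.1 this with c | c <;> linarith
    exact ⟨0, 0, rfl, rfl⟩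
  · obtain ⟨d, hde⟩ : ∃ d, d = (1 - r') * s - (1 - s') * r := ⟨_, rfl⟩
    rw [← hde] at hd
    refine ⟨⟨(s - r) * (1 - s') / d, div_nonneg p1 hd.le, (div_le_one hd).2 (by nlinarith)⟩,
      ⟨(s - r) * (1 - r') / d, div_nonneg p2 hd.le, (div_le_one hd).2 (by nlinarith)⟩, ?_, ?_⟩
    · simp only; field_simp
    · simp only; field_simp; rw [hde]; ring

/-- Chords around different vertices intersect if they meet the common side in the wrong order. -/
theorem exists_chordPt_eq_succ (h : r' ≤ s) :
    ∃ u v, chordPt i r r' u = chordPt (i + 1) s s' v := by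
  suffices H : ∃ u v : unitInterval, (1 - (u : ℝ)) * r = v * (1 - s') ∧
      (u : ℝ) * (1 - r') = (1 - v) * (1 - s) + v * s' by
    obtain ⟨u, v, h0, h1⟩ := H
    refine ⟨u, v, ext_at (i + 1) ?_ ?_ ?_⟩
    · simpa using h0
    · rw [chordPt_one, add_one_add_one, chordPt_two]
      linarith
    · rw [chordPt_two, add_one_add_two, chordPt_zero, h1]
  obtain ⟨r, h1, h2⟩ := r
  obtain ⟨r', h3, h4⟩ := r'
  obtain ⟨s, h7, h8⟩ := s
  obtain ⟨s', h9, h10⟩ := s'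
  rcases (show r' ≤ s from h).eq_or_lt with rfl | h
  · exact ⟨1, 0, by simp, by simp⟩
  simp only
  have p0 : 0 < (s - r') * (1 - s') := mul_pos (by linarith) (by linarith)
  have p1 : 0 ≤ (1 - s) * (1 - s') + r * (s' - (1 - s)) := by
    nlinarith [mul_nonneg (sub_nonneg.2 h8.le) (sub_nonneg.2 h10.le), mul_pos h1 h9,
      mul_pos (mul_pos h1 h9) h7,
      mul_nonneg (mul_nonneg (sub_nonneg.2 h8.le) (sub_nonneg.2 h10.le)) (sub_nonneg.2 h2.le)]
  have p2 : 0 ≤ (1 - r') * (1 - s') + r * (s' - (1 - r')) := by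
    nlinarith [mul_nonneg (sub_nonneg.2 h4.le) (sub_nonneg.2 h10.le), mul_pos h1 h9,
      mul_pos (mul_pos h1 h9) h3,
      mul_nonneg (mul_nonneg (sub_nonneg.2 h4.le) (sub_nonneg.2 h10.le)) (sub_nonneg.2 h2.le)]
  have hd : 0 < (1 - r') * (1 - s') + r * (s' - (1 - s)) := by nlinarith
  obtain ⟨d, hde⟩ : ∃ d, d = (1 - r') * (1 - s') + r * (s' - (1 - s)) := ⟨_, rfl⟩
  rw [← hde] at hd
  refine ⟨⟨((1 - s) * (1 - s') + r * (s' - (1 - s))) / d, div_nonneg p1 hd.le,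
      (div_le_one hd).2 (by nlinarith)⟩, ⟨(s - r') * r / d,
      div_nonneg (mul_nonneg (by linarith) h1.le) hd.le, (div_le_one hd).2 (by nlinarith)⟩, ?_, ?_⟩
  · simp only; field_simp; rw [hde]; ring
  · simp only; field_simp; rw [hde]; ring

/-- A chord, as a set, determines its sides and its ends. -/
theorem range_chordPt_inj (h : Set.range (chordPt i r r') = Set.range (chordPt j s s')) :
    i = j ∧ r = s ∧ r' = s' := by
  obtain ⟨u, hu⟩ : sidePt i r ∈ Set.range (chordPt j s s') := h ▸ ⟨0, chordPt_start i r r'⟩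
  obtain ⟨v, hv⟩ : sidePt (i + 1) r' ∈ Set.range (chordPt j s s') := h ▸ ⟨1, chordPt_end i r r'⟩
  have hu' := chordPt_eq_zero (hu ▸ sidePt_zero i r)
  have hv' := chordPt_eq_zero (hv ▸ sidePt_zero (i + 1) r')
  obtain rfl : i = j := by
    have : ∀ i j : Fin 3, (i = j ∨ i = j + 1) → (i + 1 = j ∨ i + 1 = j + 1) → i = j := by decide
    exact this i j (hu'.imp And.right And.right) (hv'.imp And.right And.right)
  have hi : ∀ i : Fin 3, i ≠ i + 1 := by decide
  obtain ⟨rfl, -⟩ := hu'.resolve_right fun c => hi i c.2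
  obtain ⟨rfl, -⟩ := hv'.resolve_left fun c => hi i c.2.symm
  exact ⟨rfl, sidePt_injective _ (hu.symm.trans (chordPt_start ..)),
    sidePt_injective _ (hv.symm.trans (chordPt_end ..))⟩

end idealTriangle

open idealTriangle in
/-- After reversing a chord if necessary, its two sides are `i` and `i + 1` for some `i`. -/
theorem IsChord.exists_range_chordPt {A : Set idealTriangle} (h : IsChord A) :
    ∃ i r r', A = Set.range (chordPt i r r') := by
  have key : ∀ (i : Fin 3) (x y : idealTriangle), x.1 i = 0 → y.1 (i + 1) = 0 →
      ∃ r r', {z : idealTriangle | z.1 ∈ segment ℝ x.1 y.1} = Set.range (chordPt i r r') := by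
    intro i x y hx hy
    obtain ⟨r, rfl⟩ := exists_eq_sidePt hx
    obtain ⟨r', rfl⟩ := exists_eq_sidePt hy
    have hc : ∀ u : unitInterval, (chordPt i r r' u).1 =
        (1 - u : ℝ) • (sidePt i r).1 + (u : ℝ) • (sidePt (i + 1) r').1 := by
      intro u
      funext j
      rcases fin_three_cases i j with rfl | rfl | rfl <;>
        simp [sidePt_succ_zero, sidePt_succ_two]
    refine ⟨r, r', Set.ext fun z => ⟨?_, ?_⟩⟩
    · rintro ⟨a, b, ha, hb, hab, hz⟩
      obtain rfl : a = 1 - b := by linarith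
      exact ⟨⟨b, hb, by linarith⟩, Subtype.ext ((hc _).trans hz)⟩
    · rintro ⟨u, rfl⟩
      exact ⟨1 - u, u, by linarith [u.2.2], u.2.1, by ring, (hc u).symm⟩
  obtain ⟨x, y, i, j, hij, hx, hy, rfl⟩ := h
  rcases fin_three_cases i j with rfl | rfl | rfl
  · exact absurd rfl hij
  · exact ⟨i, key i x y hx hy⟩
  · refine ⟨i + 2, ?_⟩
    simp_rw [segment_symm ℝ x.1]
    refine key (i + 2) y x hy ?_
    rwa [add_two_add_one]

/-! ### Systems of disjoint chords -/

namespace SidePosition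

@[simp] theorem flip_flip (r : SidePosition) : r.flip.flip = r := Subtype.ext (sub_sub_cancel _ _)

theorem flip_le_flip {r r' : SidePosition} : r.flip ≤ r'.flip ↔ r' ≤ r :=
  sub_le_sub_iff_left (1 : ℝ)

theorem flip_injective : Function.Injective flip :=
  Function.LeftInverse.injective flip_flip

end SidePosition

namespace IdealTriangulation

open idealTriangle

/-- A family of chords: `p ∈ Q (t, i)` stands for the chord in the triangle `t` from position `p.1`
of its `i`-th side to position `p.2` of its `(i + 1)`-st side. The family is noncrossing if
these chords are pairwise disjoint. For chords around the same vertex this means that they are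
nested; for chords around two vertices of a triangle, that they are apart on the common side. -/
structure IsNoncrossing {n : ℕ} (Q : Fin n × Fin 3 → Set (SidePosition × SidePosition)) :
    Prop where
  nested : ∀ s, ∀ p ∈ Q s, ∀ q ∈ Q s, p.1 ≤ q.1 → p.2 ≤ q.2 → p = q
  apart : ∀ t i, ∀ p ∈ Q (t, i), ∀ q ∈ Q (t, i + 1), q.1 < p.2

/-- The position `r` on the side `e` is the end of the chord `p ∈ Q s` that is reached at
time `u`. -/
def IsEnd {n : ℕ} (s : Fin n × Fin 3) (p : SidePosition × SidePosition) (u : unitInterval)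
    (e : Fin n × Fin 3) (r : SidePosition) : Prop :=
  (u = 0 ∧ e = s ∧ r = p.1) ∨ (u = 1 ∧ e = (s.1, s.2 + 1) ∧ r = p.2)

namespace IsNoncrossing

variable {n : ℕ} {Q : Fin n × Fin 3 → Set (SidePosition × SidePosition)} (hQ : IsNoncrossing Q)
include hQ

/-- The nesting condition: going out from the common vertex, both ends move away from it. -/
theorem lt_iff {s p q} (hp : p ∈ Q s) (hq : q ∈ Q s) : p.1 < q.1 ↔ q.2 < p.2 := by
  constructor
  · intro h
    by_contra hc
    exact h.ne (congrArg Prod.fst (hQ.nested s p hp q hq h.le (not_lt.1 hc)))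
  · intro h
    by_contra hc
    exact h.ne (congrArg Prod.snd (hQ.nested s q hq p hp (not_lt.1 hc) h.le))

theorem injOn_fst (s) : Set.InjOn Prod.fst (Q s) := fun p hp q hq h =>
  (le_total p.2 q.2).elim (hQ.nested s p hp q hq h.le)
    fun h' => (hQ.nested s q hq p hp h.ge h').symm

theorem injOn_snd (s) : Set.InjOn Prod.snd (Q s) := fun p hp q hq h =>
  (le_total p.1 q.1).elim (fun h' => hQ.nested s p hp q hq h' h.le)
    fun h' => (hQ.nested s q hq p hp h' h.ge).symm

theorem eq_of_chordPt_eq {t i j p q u v} (hp : p ∈ Q (t, i)) (hq : q ∈ Q (t, j))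
    (h : chordPt i p.1 p.2 u = chordPt j q.1 q.2 v) : i = j ∧ p = q ∧ u = v := by
  rcases fin_three_cases i j with rfl | rfl | rfl
  · have hpq : p = q := by
      rcases lt_trichotomy p.1 q.1 with hlt | heq | hlt
      · exact absurd h (chordPt_ne_of_lt hlt ((hQ.lt_iff hp hq).1 hlt))
      · exact hQ.injOn_fst _ hp hq heq
      · exact absurd h.symm (chordPt_ne_of_lt hlt ((hQ.lt_iff hq hp).1 hlt))
    subst hpq
    exact ⟨rfl, rfl, chordPt_injective _ _ _ h⟩
  · exact absurd h (chordPt_ne_of_lt_succ (hQ.apart t i p hp q hq))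
  · have hi := add_two_add_one i
    have ap := hQ.apart t (i + 2) q hq p
    rw [hi] at ap
    have := chordPt_ne_of_lt_succ (i := i + 2) (r := q.1) (s' := p.2) (u := v) (v := u) (ap hp)
    rw [hi] at this
    exact absurd h.symm this

end IsNoncrossing

variable {F : Type*} [TopologicalSpace F] (D : IdealTriangulation F)

theorem continuous_chart : Continuous D.chart := D.isQuotientMap_chart.continuous

theorem chart_sidePt_glue (s : Fin D.n × Fin 3) (r : SidePosition) :
    D.chart (s.1, sidePt s.2 r) = D.chart ((D.glue s).1, sidePt (D.glue s).2 r.flip) :=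
  (D.chart_eq_iff _ _).2 <| Or.inr ⟨s.2, (D.glue s).2, rfl, sidePt_zero _ _, sidePt_zero _ _,
    by simp [SidePosition.flip], by simp [SidePosition.flip]⟩

theorem chart_sidePt_injective (s : Fin D.n × Fin 3) :
    Function.Injective fun r => D.chart (s.1, sidePt s.2 r) := by
  intro r r' h
  rcases (D.chart_eq_iff _ _).1 h with h | ⟨i, j, hij, hi, hj, -⟩
  · exact sidePt_injective _ (congrArg Prod.snd h)
  · obtain rfl := sidePt_eq_zero_iff.1 hi
    obtain rfl := sidePt_eq_zero_iff.1 hj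
    exact absurd hij (D.glue_ne _)

theorem isEnd_of_chordPt_eq_zero {n : ℕ} {t : Fin n} {i j : Fin 3} {p u}
    (h : (chordPt i p.1 p.2 u).1 j = 0) :
    ∃ r, IsEnd (t, i) p u (t, j) r ∧ chordPt i p.1 p.2 u = sidePt j r := by
  rcases chordPt_eq_zero h with ⟨rfl, rfl⟩ | ⟨rfl, rfl⟩
  · exact ⟨p.1, Or.inl ⟨rfl, rfl, rfl⟩, chordPt_start ..⟩
  · exact ⟨p.2, Or.inr ⟨rfl, rfl, rfl⟩, chordPt_end ..⟩

theorem IsEnd.chordPt_eq {n : ℕ} {s e : Fin n × Fin 3} {p u r} (h : IsEnd s p u e r) :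
    ((s.1, chordPt s.2 p.1 p.2 u) : Fin n × idealTriangle) = (e.1, sidePt e.2 r) := by
  rcases h with ⟨rfl, rfl, rfl⟩ | ⟨rfl, rfl, rfl⟩
  · rw [chordPt_start]
  · rw [chordPt_end]

/-- The only coincidences between points of disjoint chords in the surface are those between
ends that are matched by the gluing. -/
theorem eq_or_isEnd_of_chart_eq {Q : Fin D.n × Fin 3 → Set (SidePosition × SidePosition)}
    (hQ : IsNoncrossing Q) {s s' p q u v} (hp : p ∈ Q s) (hq : q ∈ Q s')
    (h : D.chart (s.1, chordPt s.2 p.1 p.2 u) = D.chart (s'.1, chordPt s'.2 q.1 q.2 v)) :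
    (s = s' ∧ p = q ∧ u = v) ∨ ∃ e r, IsEnd s p u e r ∧ IsEnd s' q v (D.glue e) r.flip := by
  obtain ⟨t, i⟩ := s
  obtain ⟨t', i'⟩ := s'
  rcases (D.chart_eq_iff _ _).1 h with h | ⟨j, j', hj, h0, h0', h1, -⟩
  · obtain ⟨rfl, h⟩ := Prod.mk.inj h
    obtain ⟨rfl, h'⟩ := hQ.eq_of_chordPt_eq hp hq h
    exact Or.inl ⟨rfl, h'⟩
  · obtain ⟨r, hr, er⟩ := isEnd_of_chordPt_eq_zero (t := t) h0
    obtain ⟨r', hr', er'⟩ := isEnd_of_chordPt_eq_zero (t := t') h0'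
    refine Or.inr ⟨(t, j), r, hr, ?_⟩
    have hrr : r' = r.flip := by
      dsimp only at h1
      rw [er, er', sidePt_one, sidePt_two] at h1
      exact Subtype.ext h1
    dsimp only at hj
    rwa [hj, ← hrr]

/-- The positions on the side `s` at which the subset `C` of the surface crosses this side. -/
def crossings (C : Set F) (s : Fin D.n × Fin 3) : Set SidePosition :=
  {r | D.chart (s.1, sidePt s.2 r) ∈ C}

variable {D} {C : Set F}

theorem flip_mem_crossings_glue {s r} :
    r.flip ∈ D.crossings C (D.glue s) ↔ r ∈ D.crossings C s := by
  simp only [crossings, Set.mem_ofPred_eq, ← D.chart_sidePt_glue]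

theorem ncard_inter_arc (s : Fin D.n × Fin 3) :
    (C ∩ D.arc s).ncard = (D.crossings C s).ncard := by
  rw [← Set.ncard_image_of_injective _ (D.chart_sidePt_injective s)]
  congr 1
  ext y
  constructor
  · rintro ⟨hy, x, hx, rfl⟩
    obtain ⟨r, rfl⟩ := exists_eq_sidePt hx
    exact ⟨r, hy, rfl⟩
  · rintro ⟨r, hr, rfl⟩
    exact ⟨hr, _, sidePt_zero _ _, rfl⟩

/-- `C` is the union of the images of a finite noncrossing family of chords. -/
structure IsChordSystem (D : IdealTriangulation F) (C : Set F)
    (Q : Fin D.n × Fin 3 → Set (SidePosition × SidePosition)) : Prop extends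
    IsNoncrossing Q where
  finite : ∀ s, (Q s).Finite
  mem_iff : ∀ t x, D.chart (t, x) ∈ C ↔ ∃ i, ∃ p ∈ Q (t, i), ∃ u, chordPt i p.1 p.2 u = x

theorem IsNormal.exists_isChordSystem (h : D.IsNormal C) : ∃ Q, D.IsChordSystem C Q := by
  choose S hfin hch hdisj hS using h
  have heq : ∀ t, ∀ A ∈ S t, ∀ B ∈ S t, ∀ x ∈ A, x ∈ B → A = B := fun t A hA B hB x hx hx' =>
    (hdisj t).elim_set hA hB x hx hx'
  refine ⟨fun s => {p | Set.range (chordPt s.2 p.1 p.2) ∈ S s.1}, ⟨?_, ?_⟩, ?_, ?_⟩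
  · rintro s p hp q hq h1 h2
    obtain ⟨u, v, huv⟩ := exists_chordPt_eq (i := s.2) h1 h2
    have := range_chordPt_inj (heq s.1 _ hp _ hq _ ⟨u, rfl⟩ ⟨v, huv.symm⟩)
    exact Prod.ext this.2.1 this.2.2
  · rintro t i p hp q hq
    by_contra hc
    obtain ⟨u, v, huv⟩ := exists_chordPt_eq_succ (i := i) (r := p.1) (s' := q.2) (not_lt.1 hc)
    have hi : ∀ i : Fin 3, i ≠ i + 1 := by decide
    exact hi i (range_chordPt_inj (heq t _ hp _ hq _ ⟨u, rfl⟩ ⟨v, huv.symm⟩)).1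
  · intro s
    refine (hfin s.1).preimage (f := fun p : SidePosition × SidePosition =>
      Set.range (chordPt s.2 p.1 p.2)) fun p _ q _ hpq => ?_
    have := range_chordPt_inj hpq
    exact Prod.ext this.2.1 this.2.2
  · intro t x
    have hx : D.chart (t, x) ∈ C ↔ x ∈ ⋃₀ S t := by rw [← hS]; rfl
    rw [hx]
    constructor
    · rintro ⟨A, hA, hxA⟩
      obtain ⟨i, r, r', rfl⟩ := (hch t A hA).exists_range_chordPt
      exact ⟨i, (r, r'), hA, hxA⟩
    · rintro ⟨i, p, hp, hu⟩
      exact ⟨_, hp, hu⟩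

namespace IsChordSystem

variable {Q : Fin D.n × Fin 3 → Set (SidePosition × SidePosition)} (hC : D.IsChordSystem C Q)
include hC

theorem isEnd_mem_crossings {s p u e r} (hp : p ∈ Q s) (h : IsEnd s p u e r) :
    r ∈ D.crossings C e := by
  change D.chart (e.1, sidePt e.2 r) ∈ C
  rw [← h.chordPt_eq]
  exact (hC.mem_iff _ _).2 ⟨s.2, p, hp, u, rfl⟩

theorem exists_isEnd {e r} (h : r ∈ D.crossings C e) : ∃ s, ∃ p ∈ Q s, ∃ u, IsEnd s p u e r := by
  obtain ⟨i, p, hp, u, hu⟩ := (hC.mem_iff _ _).1 h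
  obtain ⟨r', h1, h2⟩ := isEnd_of_chordPt_eq_zero (t := e.1) (hu ▸ sidePt_zero e.2 r)
  obtain rfl := sidePt_injective _ (hu.symm.trans h2)
  exact ⟨_, p, hp, u, h1⟩

theorem crossings_succ (t : Fin D.n) (i : Fin 3) :
    D.crossings C (t, i + 1) = Prod.fst '' Q (t, i + 1) ∪ Prod.snd '' Q (t, i) := by
  ext r
  constructor
  · intro h
    obtain ⟨⟨t', j⟩, p, hp, u, ⟨-, h1, rfl⟩ | ⟨-, h1, rfl⟩⟩ := hC.exists_isEnd h
    · exact Or.inl ⟨p, h1 ▸ hp, rfl⟩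
    · obtain ⟨rfl, h1⟩ := Prod.mk.inj h1
      exact Or.inr ⟨p, add_right_cancel h1 ▸ hp, rfl⟩
  · rintro (⟨p, hp, rfl⟩ | ⟨p, hp, rfl⟩)
    · exact hC.isEnd_mem_crossings hp (Or.inl ⟨rfl, rfl, rfl⟩)
    · exact hC.isEnd_mem_crossings hp (Or.inr ⟨rfl, rfl, rfl⟩)

theorem ncard_crossings_succ (t : Fin D.n) (i : Fin 3) :
    (D.crossings C (t, i + 1)).ncard = (Q (t, i + 1)).ncard + (Q (t, i)).ncard := by
  rw [hC.crossings_succ, Set.ncard_union_eq ?_ ((hC.finite _).image _) ((hC.finite _).image _),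
    (hC.injOn_fst _).ncard_image, (hC.injOn_snd _).ncard_image]
  rw [Set.disjoint_left]
  rintro _ ⟨q, hq, rfl⟩ ⟨p, hp, h⟩
  exact (hC.apart t i p hp q hq).ne' h

theorem finite_crossings (e : Fin D.n × Fin 3) : (D.crossings C e).Finite := by
  obtain ⟨t, i⟩ := e
  have hi := add_two_add_one i
  rw [← hi, hC.crossings_succ]
  exact ((hC.finite _).image _).union ((hC.finite _).image _)

theorem eq_iUnion : C = ⋃ x : Σ s, Q s,
    Set.range fun u => D.chart (x.1.1, chordPt x.1.2 x.2.1.1 x.2.1.2 u) := by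
  ext y
  obtain ⟨⟨t, x⟩, rfl⟩ := D.isQuotientMap_chart.surjective y
  simp only [Set.mem_iUnion, Set.mem_range]
  constructor
  · intro h
    obtain ⟨i, p, hp, u, rfl⟩ := (hC.mem_iff _ _).1 h
    exact ⟨⟨(t, i), p, hp⟩, u, rfl⟩
  · rintro ⟨⟨s, p, hp⟩, u, h⟩
    rw [← h]
    exact (hC.mem_iff _ _).2 ⟨s.2, p, hp, u, rfl⟩

end IsChordSystem

/-! ### Outermost crossings -/

/-- The position `r` is the first or the last one among the crossings of `C` with the side `s`. -/
def IsOutermost (D : IdealTriangulation F) (C : Set F) (s : Fin D.n × Fin 3) (r : SidePosition) :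
    Prop :=
  (∀ r' ∈ D.crossings C s, r' ≤ r) ∨ ∀ r' ∈ D.crossings C s, r ≤ r'

theorem IsOutermost.glue {s r} (h : D.IsOutermost C s r) : D.IsOutermost C (D.glue s) r.flip := by
  have key : ∀ r' ∈ D.crossings C (D.glue s), r'.flip ∈ D.crossings C s := fun r' hr' => by
    rwa [← flip_mem_crossings_glue, SidePosition.flip_flip]
  refine h.symm.imp (fun h r' hr' => ?_) fun h r' hr' => ?_
  · rw [← SidePosition.flip_le_flip, SidePosition.flip_flip]; exact h _ (key r' hr')
  · rw [← SidePosition.flip_le_flip, SidePosition.flip_flip]; exact h _ (key r' hr')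

theorem isOutermost_glue_iff {s r} :
    D.IsOutermost C (D.glue s) r.flip ↔ D.IsOutermost C s r :=
  ⟨fun h => by simpa [D.glue_glue s] using h.glue, IsOutermost.glue⟩

theorem ncard_crossings_le_two {s} (h : ∀ r ∈ D.crossings C s, D.IsOutermost C s r) :
    (D.crossings C s).ncard ≤ 2 := by
  by_contra! hc
  obtain ⟨a, b, c, ha, hb, hc, hab, hac, hbc⟩ :=
    (Set.two_lt_ncard_iff (Set.finite_of_ncard_pos (by omega))).1 hc
  -- among three crossings, two are both the first one or both the last one
  rcases h a ha with h1 | h1 <;> rcases h b hb with h2 | h2 <;> rcases h c hc with h3 | h3 <;>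
  first
  | exact hab (le_antisymm (h2 a ha) (h1 b hb))
  | exact hab (le_antisymm (h1 b hb) (h2 a ha))
  | exact hac (le_antisymm (h3 a ha) (h1 c hc))
  | exact hac (le_antisymm (h1 c hc) (h3 a ha))
  | exact hbc (le_antisymm (h3 b hb) (h2 c hc))
  | exact hbc (le_antisymm (h2 c hc) (h3 b hb))

namespace IsChordSystem

variable {Q : Fin D.n × Fin 3 → Set (SidePosition × SidePosition)} (hC : D.IsChordSystem C Q)
include hC

/-- In terms of the numbers of chords around the three vertices of a triangle, the tropical
triangle inequalities say that the two smallest of them are equal. -/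
theorem min_ncard_le
    (hT : ∀ t i, (D.crossings C (t, i)).ncard ≤
      max (D.crossings C (t, i + 1)).ncard (D.crossings C (t, i + 2)).ncard) (t : Fin D.n)
    (i : Fin 3) : min (Q (t, i)).ncard (Q (t, i + 1)).ncard ≤ (Q (t, i + 2)).ncard := by
  have h := hT t (i + 1)
  have e1 := add_one_add_one i
  have e2 := add_one_add_two i
  have e3 := add_two_add_one i
  have h0 := hC.ncard_crossings_succ t i
  have h1 := hC.ncard_crossings_succ t (i + 1)
  have h2 := hC.ncard_crossings_succ t (i + 2)
  rw [e1] at h1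
  rw [e3] at h2
  rw [e1, e2] at h
  omega

/-- Under the tropical triangle inequalities, a chord starts in an outermost crossing if and only
if it ends in one. -/
theorem isOutermost_iff
    (hT : ∀ t i, (D.crossings C (t, i)).ncard ≤
      max (D.crossings C (t, i + 1)).ncard (D.crossings C (t, i + 2)).ncard) {t : Fin D.n}
    {i : Fin 3} {p} (hp : p ∈ Q (t, i)) :
    D.IsOutermost C (t, i) p.1 ↔ D.IsOutermost C (t, i + 1) p.2 := by
  have e2 := add_one_add_two i
  have e3 := add_two_add_one i
  have e4 := add_two_add_two i
  have c1 := hC.crossings_succ t i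
  have c0 := hC.crossings_succ t (i + 2)
  have m0 := hC.min_ncard_le hT t i
  have m2 := hC.min_ncard_le hT t (i + 2)
  have ap := hC.apart t (i + 2)
  rw [e3] at c0 ap
  rw [e3, e4] at m2
  have hpos : 0 < (Q (t, i)).ncard := (Set.ncard_pos (hC.finite _)).2 ⟨p, hp⟩
  have hemp : ∀ s, (Q s).ncard = 0 → Q s = ∅ := fun s => (Set.ncard_eq_zero (hC.finite s)).1
  have hle : ∀ q ∈ Q (t, i), p.1 ≤ q.1 ↔ q.2 ≤ p.2 := fun q hq => by
    rw [← not_lt, ← not_lt, hC.lt_iff hq hp]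
  have hle' : ∀ q ∈ Q (t, i), q.1 ≤ p.1 ↔ p.2 ≤ q.2 := fun q hq => by
    rw [← not_lt, ← not_lt, hC.lt_iff hp hq]
  simp only [IsOutermost, c0, c1, Set.forall_mem_image, Set.mem_union, or_imp, forall_and]
  constructor
  · rintro (⟨h1, h2⟩ | ⟨h1, h2⟩)
    · -- a chord around the vertex `i + 1` would end beyond the last crossing, so there is none;
      -- by the inequalities, there is none around `i` either
      have hE : Q (t, i + 2) = ∅ := Set.eq_empty_of_forall_notMem fun q hq =>
        (h2 hq).not_gt (ap q hq p hp)
      have hE' : Q (t, i + 1) = ∅ := hemp _ (by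
        rw [hE, Set.ncard_empty] at m0
        omega)
      exact Or.inr ⟨by simp [hE'], fun q hq => (hle' q hq).1 (h1 hq)⟩
    · exact Or.inl ⟨fun q hq => (hC.apart t i p hp q hq).le, fun q hq => (hle q hq).1 (h1 hq)⟩
  · rintro (⟨h1, h2⟩ | ⟨h1, h2⟩)
    · exact Or.inr ⟨fun q hq => (hle q hq).2 (h2 hq), fun q hq => (ap q hq p hp).le⟩
    · have hE : Q (t, i + 1) = ∅ := Set.eq_empty_of_forall_notMem fun q hq =>
        (h1 hq).not_gt (hC.apart t i p hp q hq)
      have hE' : Q (t, i + 2) = ∅ := hemp _ (by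
        rw [hE, Set.ncard_empty] at m2
        omega)
      exact Or.inl ⟨fun q hq => (hle' q hq).2 (h2 hq), by simp [hE']⟩

theorem isOutermost_iff_of_isEnd
    (hT : ∀ t i, (D.crossings C (t, i)).ncard ≤
      max (D.crossings C (t, i + 1)).ncard (D.crossings C (t, i + 2)).ncard) {s p u e r}
    (hp : p ∈ Q s) (h : IsEnd s p u e r) : D.IsOutermost C e r ↔ D.IsOutermost C s p.1 := by
  rcases h with ⟨-, rfl, rfl⟩ | ⟨-, rfl, rfl⟩
  · rfl
  · exact (hC.isOutermost_iff hT hp).symm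

/-- If a connected system of chords satisfies the tropical triangle inequalities, then all its
crossings are outermost: the chords with outermost ends and the other ones form disjoint closed
sets. -/
theorem isOutermost_of_isPreconnected [T2Space F] (hconn : IsPreconnected C)
    (hT : ∀ t i, (D.crossings C (t, i)).ncard ≤
      max (D.crossings C (t, i + 1)).ncard (D.crossings C (t, i + 2)).ncard) {s r}
    (hr : r ∈ D.crossings C s) : D.IsOutermost C s r := by
  let K : (Σ s, Q s) → Set F := fun x =>
    Set.range fun u => D.chart (x.1.1, chordPt x.1.2 x.2.1.1 x.2.1.2 u)
  have hK : ∀ x, IsClosed (K x) := fun x => by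
    refine (isCompact_range (D.continuous_chart.comp ?_)).isClosed
    exact Continuous.prodMk continuous_const
      ((continuous_chordPt x.1.2).comp (Continuous.prodMk_right x.2.1))
  have : ∀ s, Finite (Q s) := hC.finite
  let O : (Σ s, Q s) → Prop := fun x => D.IsOutermost C x.1 x.2.1.1
  have hU : ∀ P : (Σ s, Q s) → Prop, IsClosed (⋃ x ∈ {x | P x}, K x) := fun P =>
    (Set.toFinite _).isClosed_biUnion fun x _ => hK x
  have hcov : C ⊆ (⋃ x ∈ {x | O x}, K x) ∪ ⋃ x ∈ {x | ¬ O x}, K x := by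
    rw [← Set.biUnion_union, hC.eq_iUnion]
    refine Set.iUnion_subset fun x => ?_
    exact Set.subset_biUnion_of_mem (u := K) (em (O x))
  have hmem : ∀ {s p u e r} (hp : p ∈ Q s), IsEnd s p u e r →
      D.chart (e.1, sidePt e.2 r) ∈ K ⟨s, p, hp⟩ := fun hp h => ⟨_, congrArg D.chart h.chordPt_eq⟩
  by_contra hnot
  obtain ⟨m, hm, hmax⟩ := (hC.finite_crossings s).exists_maximal ⟨r, hr⟩
  have hmO : D.IsOutermost C s m := Or.inl fun r' hr' =>
    (le_total r' m).elim id fun h => hmax hr' h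
  obtain ⟨s1, p1, hp1, u1, he1⟩ := hC.exists_isEnd hm
  obtain ⟨s2, p2, hp2, u2, he2⟩ := hC.exists_isEnd hr
  obtain ⟨y, -, hy1, hy2⟩ := isPreconnected_closed_iff.1 hconn _ _ (hU O) (hU fun x => ¬ O x) hcov
    ⟨_, hm, Set.mem_biUnion (x := ⟨s1, p1, hp1⟩)
      ((hC.isOutermost_iff_of_isEnd hT hp1 he1).1 hmO) (hmem hp1 he1)⟩
    ⟨_, hr, Set.mem_biUnion (x := ⟨s2, p2, hp2⟩)
      (fun h => hnot ((hC.isOutermost_iff_of_isEnd hT hp2 he2).2 h)) (hmem hp2 he2)⟩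
  simp only [Set.mem_iUnion] at hy1 hy2
  obtain ⟨⟨s, p, hp⟩, hO, u, rfl⟩ := hy1
  obtain ⟨⟨s', q, hq⟩, hO', v, huv⟩ := hy2
  rcases D.eq_or_isEnd_of_chart_eq hC.toIsNoncrossing hp hq huv.symm with
    ⟨rfl, rfl, -⟩ | ⟨e, r, h1, h2⟩
  · exact hO' hO
  · refine hO' ((hC.isOutermost_iff_of_isEnd hT hq h2).1 ?_)
    exact isOutermost_glue_iff.2 ((hC.isOutermost_iff_of_isEnd hT hp h1).2 hO)

end IsChordSystem

theorem IsNormal.ncard_crossings_le_two [T2Space F] (hN : D.IsNormal C) (hconn : IsPreconnected C)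
    (hT : ∀ t i, (D.crossings C (t, i)).ncard ≤
      max (D.crossings C (t, i + 1)).ncard (D.crossings C (t, i + 2)).ncard) (s) :
    (D.crossings C s).ncard ≤ 2 := by
  obtain ⟨Q, hC⟩ := hN.exists_isChordSystem
  exact IdealTriangulation.ncard_crossings_le_two fun r =>
    hC.isOutermost_of_isPreconnected hconn hT

end IdealTriangulation

/-! ### Isotopies between systems of chords with the same combinatorics -/

namespace IdealTriangulation

open idealTriangle

/-- If there are `N s` crossings on each side `s`, numbered in increasing order of positions, a
possible chord is given by the side where it starts and by the numbers of its two ends. -/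
abbrev ChordIndex {n : ℕ} (N : Fin n × Fin 3 → ℕ) : Type :=
  Σ s : Fin n × Fin 3, Fin (N s) × Fin (N (s.1, s.2 + 1))

variable {F : Type*} [TopologicalSpace F] (D : IdealTriangulation F) {N : Fin D.n × Fin 3 → ℕ}

/-- The numbers `pos s a` can serve as the positions of `N s` crossings on each side `s`, numbered
in increasing order: they are compatible with the gluing, which reverses the numbering. -/
structure IsPositioning (pos : ∀ s, Fin (N s) → SidePosition) : Prop where
  card_glue : ∀ s, N (D.glue s) = N s
  strictMono : ∀ s, StrictMono (pos s)
  glue : ∀ s (a : Fin (N s)) (b : Fin (N (D.glue s))), (a : ℕ) + b + 1 = N s →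
    pos (D.glue s) b = (pos s a).flip

variable {D} in
/-- The chords with given combinatorics `K` and given positions of their ends. -/
def chordFamily (K : Set (ChordIndex N)) (pos : ∀ s, Fin (N s) → SidePosition)
    (s : Fin D.n × Fin 3) : Set (SidePosition × SidePosition) :=
  {p | ∃ a b, ⟨s, a, b⟩ ∈ K ∧ p = (pos s a, pos (s.1, s.2 + 1) b)}

/-- The parametrization of the chords with given combinatorics `K` and given positions. -/
def chordMap (K : Set (ChordIndex N)) (pos : ∀ s, Fin (N s) → SidePosition)
    (x : K × unitInterval) : F :=
  D.chart (x.1.1.1.1, chordPt x.1.1.1.2 (pos _ x.1.1.2.1) (pos _ x.1.1.2.2) x.2)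

variable {D} {K : Set (ChordIndex N)} {pos pos' : ∀ s, Fin (N s) → SidePosition}

/-- Whether chords cross depends only on their combinatorics. -/
theorem IsNoncrossing.congr (h : IsNoncrossing (chordFamily K pos)) (hp : ∀ s, StrictMono (pos s))
    (hp' : ∀ s, StrictMono (pos' s)) : IsNoncrossing (chordFamily K pos') := by
  constructor
  · rintro s _ ⟨a, b, hab, rfl⟩ _ ⟨c, d, hcd, rfl⟩ h1 h2
    have := h.nested s _ ⟨a, b, hab, rfl⟩ _ ⟨c, d, hcd, rfl⟩
      ((hp _).monotone ((hp' _).le_iff_le.1 h1)) ((hp _).monotone ((hp' _).le_iff_le.1 h2))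
    obtain ⟨e1, e2⟩ := Prod.mk.inj this
    rw [(hp _).injective e1, (hp _).injective e2]
  · rintro t i _ ⟨a, b, hab, rfl⟩ _ ⟨c, d, hcd, rfl⟩
    exact hp' _ ((hp _).lt_iff_lt.1 (h.apart t i _ ⟨a, b, hab, rfl⟩ _ ⟨c, d, hcd, rfl⟩))

theorem exists_isEnd_pos {s e : Fin D.n × Fin 3} {a b u r}
    (h : IsEnd s (pos s a, pos (s.1, s.2 + 1) b) u e r) :
    ∃ c, r = pos e c ∧ ∀ pos' : ∀ s, Fin (N s) → SidePosition,
      IsEnd s (pos' s a, pos' (s.1, s.2 + 1) b) u e (pos' e c) := by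
  rcases h with ⟨rfl, rfl, rfl⟩ | ⟨rfl, rfl, rfl⟩
  · exact ⟨a, rfl, fun _ => Or.inl ⟨rfl, rfl, rfl⟩⟩
  · exact ⟨b, rfl, fun _ => Or.inr ⟨rfl, rfl, rfl⟩⟩

/-- The identifications between points of disjoint chords depend only on the combinatorics. -/
theorem chordMap_eq_of_eq (hpos : D.IsPositioning pos) (hpos' : D.IsPositioning pos')
    (hK : IsNoncrossing (chordFamily K pos)) {x y : K × unitInterval}
    (h : D.chordMap K pos x = D.chordMap K pos y) : D.chordMap K pos' x = D.chordMap K pos' y := by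
  obtain ⟨⟨⟨s, a, b⟩, hx⟩, u⟩ := x
  obtain ⟨⟨⟨s', a', b'⟩, hy⟩, v⟩ := y
  rcases D.eq_or_isEnd_of_chart_eq hK (s := s) (s' := s') ⟨a, b, hx, rfl⟩ ⟨a', b', hy, rfl⟩ h with
    ⟨rfl, hp, rfl⟩ | ⟨e, r, h1, h2⟩
  · obtain ⟨e1, e2⟩ := Prod.mk.inj hp
    obtain rfl := (hpos.strictMono _).injective e1
    obtain rfl := (hpos.strictMono _).injective e2
    rfl
  · obtain ⟨c, rfl, h3⟩ := exists_isEnd_pos h1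
    obtain ⟨d, hd, h2⟩ := exists_isEnd_pos h2
    have hcd : (c : ℕ) + d + 1 = N e := by
      have hlt : N e - 1 - c < N (D.glue e) := by rw [hpos.card_glue]; omega
      have hc : (c : ℕ) + (⟨_, hlt⟩ : Fin (N (D.glue e))) + 1 = N e := by
        have := c.2
        dsimp only
        omega
      rwa [(hpos.strictMono _).injective ((hpos.glue e c _ hc).trans hd)] at hc
    have h2 := h2 pos'
    rw [hpos'.glue e c d hcd] at h2
    calc D.chordMap K pos' _ = _ := congrArg D.chart (h3 pos').chordPt_eq
      _ = _ := D.chart_sidePt_glue e _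
      _ = _ := (congrArg D.chart h2.chordPt_eq).symm

/-- Linear interpolation of positions. -/
def interpolate (pos pos' : ∀ s, Fin (N s) → SidePosition) (τ : unitInterval) (s : Fin D.n × Fin 3)
    (a : Fin (N s)) : SidePosition :=
  ⟨(1 - τ) * pos s a + τ * pos' s a, convex_Ioo (0 : ℝ) 1 (pos s a).2 (pos' s a).2
    (sub_nonneg.2 τ.2.2) τ.2.1 (by ring)⟩

theorem interpolate_zero : interpolate pos pos' 0 = pos := by
  funext s a
  simp [interpolate]

theorem interpolate_one : interpolate pos pos' 1 = pos' := by
  funext s a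
  simp [interpolate]

theorem IsPositioning.interpolate (h : D.IsPositioning pos) (h' : D.IsPositioning pos')
    (τ : unitInterval) : D.IsPositioning (interpolate pos pos' τ) := by
  refine ⟨h.card_glue, fun s a b hab => ?_, fun s a b hab => Subtype.ext ?_⟩
  · have h1 : (pos s a : ℝ) < pos s b := h.strictMono s hab
    have h2 : (pos' s a : ℝ) < pos' s b := h'.strictMono s hab
    change (1 - (τ : ℝ)) * pos s a + τ * pos' s a < (1 - τ) * pos s b + τ * pos' s b
    rcases τ.2.1.eq_or_lt with h0 | h0
    · rw [← h0]; linarith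
    · exact add_lt_add_of_le_of_lt (mul_le_mul_of_nonneg_left h1.le (sub_nonneg.2 τ.2.2))
        (mul_lt_mul_of_pos_left h2 h0)
  · simp only [IdealTriangulation.interpolate, h.glue s a b hab, h'.glue s a b hab,
      SidePosition.flip]
    ring

theorem continuous_chordMap_interpolate (K : Set (ChordIndex N))
    (pos pos' : ∀ s, Fin (N s) → SidePosition) :
    Continuous fun p : unitInterval × (K × unitInterval) =>
      D.chordMap K (interpolate pos pos' p.1) p.2 := by
  have key : Continuous fun q : K × (unitInterval × unitInterval) =>
      D.chordMap K (interpolate pos pos' q.2.1) (q.1, q.2.2) := by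
    refine continuous_prod_of_discrete_left.2 fun k => ?_
    have hpos : ∀ s a, Continuous fun q : unitInterval × unitInterval =>
        interpolate pos pos' q.1 s a := fun s a =>
      Continuous.subtype_mk (by fun_prop) _
    have hchord := (continuous_chordPt k.1.1.2).comp
      (((hpos k.1.1 k.1.2.1).prodMk (hpos _ k.1.2.2)).prodMk continuous_snd)
    exact D.continuous_chart.comp ((continuous_const (y := k.1.1.1)).prodMk hchord)
  exact key.comp (f := fun p : unitInterval × (K × unitInterval) => (p.2.1, (p.1, p.2.2)))
    (by fun_prop)

/-- Simple closed curves that consist of chords with the same combinatorics are isotopic: move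
the crossings linearly. -/
theorem isotopic_of_chordMap [T2Space F] {C C' : SimpleClosedCurve F} (hpos : D.IsPositioning pos)
    (hpos' : D.IsPositioning pos') (hK : IsNoncrossing (chordFamily K pos))
    (hC : C.1 = Set.range (D.chordMap K pos)) (hC' : C'.1 = Set.range (D.chordMap K pos')) :
    Isotopic C C' := by
  obtain ⟨f, hf, hfC⟩ := C.2
  have hcont := continuous_chordMap_interpolate (D := D) K pos pos'
  have hpt := fun τ => hpos.interpolate hpos' τ
  have hKt : ∀ τ, IsNoncrossing (chordFamily K (interpolate pos pos' τ)) := fun τ =>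
    hK.congr hpos.strictMono (hpt τ).strictMono
  have hc0 : Continuous (D.chordMap K pos) := by
    have := hcont.comp (Continuous.prodMk_right (0 : unitInterval))
    simpa only [Function.comp_def, interpolate_zero] using this
  have hrange : ∀ x, D.chordMap K pos x ∈ Set.range f := fun x => by
    rw [hfC, hC]; exact ⟨x, rfl⟩
  -- the circle is a quotient of the disjoint union of the chords
  choose g hg using hrange
  have hgc : Continuous g := hf.continuous_iff.2 (by simpa only [Function.comp_def, hg] using hc0)
  have hgs : Function.Surjective g := fun z => by
    obtain ⟨x, hx⟩ : f z ∈ Set.range (D.chordMap K pos) := by rw [← hC, ← hfC]; exact ⟨z, rfl⟩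
    exact ⟨x, hf.injective ((hg x).trans hx)⟩
  have hgeq : ∀ x y, g x = g y ↔ D.chordMap K pos x = D.chordMap K pos y := fun x y => by
    rw [← hg, ← hg, hf.injective.eq_iff]
  have hq : IsQuotientMap (Prod.map (id : unitInterval → unitInterval) g) :=
    IsQuotientMap.of_surjective_continuous (Function.surjective_id.prodMap hgs)
      (continuous_id.prodMap hgc)
  let Φ : C(unitInterval × (K × unitInterval), F) := ⟨_, hcont⟩
  have hΦ : ∀ a b, Prod.map (id : unitInterval → unitInterval) g a = Prod.map id g b →
      Φ a = Φ b := by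
    rintro ⟨τ, x⟩ ⟨τ', y⟩ h
    obtain ⟨hτ, h'⟩ := Prod.mk.inj h
    obtain rfl : τ = τ' := hτ
    exact chordMap_eq_of_eq hpos (hpt _) hK ((hgeq x y).1 h')
  let H : C(unitInterval × Circle, F) := hq.lift (f := ⟨_, hq.continuous⟩) Φ hΦ
  have hH : ∀ τ x, H (τ, g x) = D.chordMap K (interpolate pos pos' τ) x := fun τ x =>
    congrArg (fun φ : C(_, F) => φ (τ, x))
      (IsQuotientMap.lift_comp (f := ⟨_, hq.continuous⟩) hq Φ hΦ)
  have hr : ∀ τ, (Set.range fun z => H (τ, z)) =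
      Set.range (D.chordMap K (interpolate pos pos' τ)) := fun τ => by
    rw [← hgs.range_comp]
    exact congrArg Set.range (funext (hH τ))
  refine ⟨H, H.continuous, fun τ => ?_, ?_, ?_⟩
  · refine (Continuous.isClosedEmbedding (by fun_prop) fun z w h => ?_).isEmbedding
    obtain ⟨x, rfl⟩ := hgs z
    obtain ⟨y, rfl⟩ := hgs w
    simp only [hH] at h
    exact (hgeq x y).2 (chordMap_eq_of_eq (hpt τ) hpos (hKt τ) h)
  · rw [hr, interpolate_zero, hC]
  · rw [hr, interpolate_one, hC']

/-- Every system of chords is determined by its combinatorics and the positions of its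
crossings. -/
theorem IsChordSystem.exists_chordMap {C : Set F}
    {Q : Fin D.n × Fin 3 → Set (SidePosition × SidePosition)} (hC : D.IsChordSystem C Q)
    (hN : ∀ s, (D.crossings C s).ncard = N s) :
    ∃ (K : Set (ChordIndex N)) (pos : ∀ s, Fin (N s) → SidePosition), D.IsPositioning pos ∧
      IsNoncrossing (chordFamily K pos) ∧ C = Set.range (D.chordMap K pos) := by
  have hcard : ∀ s, (hC.finite_crossings s).toFinset.card = N s := fun s => by
    rw [← hN, Set.ncard_eq_toFinset_card _ (hC.finite_crossings s)]
  let pos : ∀ s, Fin (N s) → SidePosition := fun s =>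
    (hC.finite_crossings s).toFinset.orderEmbOfFin (hcard s)
  have hmono : ∀ s, StrictMono (pos s) := fun s => OrderEmbedding.strictMono _
  have hmem : ∀ s a, pos s a ∈ D.crossings C s := fun s a =>
    (hC.finite_crossings s).mem_toFinset.1 (Finset.orderEmbOfFin_mem _ _ a)
  have hsurj : ∀ s, ∀ r ∈ D.crossings C s, ∃ a, pos s a = r := fun s r hr => by
    have := Finset.range_orderEmbOfFin _ (hcard s)
    rw [Set.Finite.coe_toFinset] at this
    rw [← this] at hr
    exact hr
  have hglue : ∀ s, N (D.glue s) = N s := fun s => by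
    rw [← hN, ← hN, ← Set.ncard_image_of_injective (D.crossings C s) SidePosition.flip_injective]
    congr 1
    ext r
    constructor
    · intro hr
      exact ⟨r.flip, by rwa [← flip_mem_crossings_glue, SidePosition.flip_flip], r.flip_flip⟩
    · rintro ⟨r, hr, rfl⟩
      exact flip_mem_crossings_glue.2 hr
  let K : Set (ChordIndex N) := {k | (pos _ k.2.1, pos _ k.2.2) ∈ Q k.1}
  have hK : chordFamily K pos = Q := by
    funext s
    ext p
    constructor
    · rintro ⟨a, b, hab, rfl⟩
      exact hab
    · intro hp
      obtain ⟨a, ha⟩ := hsurj s p.1 (hC.isEnd_mem_crossings hp (Or.inl ⟨rfl, rfl, rfl⟩))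
      obtain ⟨b, hb⟩ := hsurj _ p.2 (hC.isEnd_mem_crossings hp (Or.inr ⟨rfl, rfl, rfl⟩))
      have hab : p = (pos s a, pos (s.1, s.2 + 1) b) := by rw [ha, hb]
      exact ⟨a, b, by rw [hab] at hp; exact hp, hab⟩
  refine ⟨K, pos, ⟨hglue, hmono, fun s a b hab => ?_⟩, hK.symm ▸ hC.toIsNoncrossing, ?_⟩
  · -- reversing the enumeration on the other side gives the increasing enumeration
    have hu := Finset.orderEmbOfFin_unique (hcard s)
      (f := fun c => (pos (D.glue s) (c.rev.cast (hglue s).symm)).flip)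
      (fun c => by
        rw [Set.Finite.mem_toFinset, ← flip_mem_crossings_glue, SidePosition.flip_flip]
        exact hmem _ _)
      (fun c d hcd => by
        refine lt_of_not_ge fun h => ?_
        rw [SidePosition.flip_le_flip, (hmono _).le_iff_le] at h
        simp only [Fin.le_def, Fin.val_cast, Fin.val_rev] at h
        have := Fin.lt_def.1 hcd
        omega)
    have ha : (pos (D.glue s) (a.rev.cast (hglue s).symm)).flip = pos s a := congrFun hu a
    rw [← ha, SidePosition.flip_flip]
    congr 1
    apply Fin.ext
    simp only [Fin.val_cast, Fin.val_rev]
    omega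
  · refine hC.eq_iUnion.trans ?_
    ext y
    simp only [Set.mem_iUnion, Set.mem_range]
    constructor
    · rintro ⟨⟨s, p, hp⟩, u, rfl⟩
      obtain ⟨a, b, hab, rfl⟩ : p ∈ chordFamily K pos s := hK.symm ▸ hp
      exact ⟨(⟨⟨s, a, b⟩, hab⟩, u), rfl⟩
    · rintro ⟨⟨⟨⟨s, a, b⟩, hab⟩, u⟩, rfl⟩
      exact ⟨⟨s, _, hab⟩, u, rfl⟩

/-- Up to isotopy there are only finitely many normal curves with a bounded number of crossings
with each edge. -/
theorem finite_isotopy_classes [T2Space F] (D : IdealTriangulation F) (B : ℕ) :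
    {c : Quotient (isotopySetoid F) | ∃ C : SimpleClosedCurve F,
      Quotient.mk (isotopySetoid F) C = c ∧ D.IsNormal C.1 ∧
        ∀ s, (D.crossings C.1 s).ncard ≤ B}.Finite := by
  let P : Type := Σ N : Fin D.n × Fin 3 → Fin (B + 1), Set (ChordIndex fun s => (N s : ℕ))
  let R : P → Set (Quotient (isotopySetoid F)) := fun x =>
    {c | ∃ C : SimpleClosedCurve F, Quotient.mk (isotopySetoid F) C = c ∧
      ∃ pos, D.IsPositioning pos ∧ IsNoncrossing (chordFamily x.2 pos) ∧
        C.1 = Set.range (D.chordMap x.2 pos)}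
  have hR : (⋃ x, R x).Finite := by
    refine Set.finite_iUnion fun x => Set.Subsingleton.finite ?_
    rintro _ ⟨C, rfl, pos, h1, h2, h3⟩ _ ⟨C', rfl, pos', h1', -, h3'⟩
    exact Quotient.sound (isotopic_of_chordMap h1 h1' h2 h3 h3')
  refine hR.subset ?_
  rintro _ ⟨C, rfl, hC, hB⟩
  obtain ⟨Q, hQ⟩ := hC.exists_isChordSystem
  obtain ⟨K, pos, h⟩ := hQ.exists_chordMap
    (N := fun s => ((⟨(D.crossings C.1 s).ncard, Nat.lt_succ_of_le (hB s)⟩ : Fin (B + 1)) : ℕ))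
    fun _ => rfl
  exact Set.mem_iUnion.2 ⟨⟨fun s => ⟨_, Nat.lt_succ_of_le (hB s)⟩, K⟩, C, rfl, pos, h⟩

theorem isPreconnected_simpleClosedCurve (C : SimpleClosedCurve F) : IsPreconnected C.1 := by
  obtain ⟨f, hf, hC⟩ := C.2
  rw [← hC]
  exact isPreconnected_range hf.continuous

/-- A normal curve whose numbers of crossings satisfy the tropical triangle inequalities crosses
each edge at most twice. -/
theorem ncard_crossings_le_two_of_tropicalTriangle [T2Space F] {μ : D.Edge → ℤ}
    (hT : D.TropicalTriangle μ) {C : SimpleClosedCurve F} (hN : D.IsNormal C.1)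
    (hμ : ∀ e : D.Edge, μ e = ((C.1 ∩ e.1).ncard : ℤ)) (s) : (D.crossings C.1 s).ncard ≤ 2 := by
  refine hN.ncard_crossings_le_two (isPreconnected_simpleClosedCurve C) (fun t i => ?_) s
  have := hT t i
  simp only [hμ, edge, ncard_inter_arc] at this
  exact_mod_cast this

end IdealTriangulation

theorem corollary2p4 {F : Type*} [TopologicalSpace F] [T2Space F] [ConnectedSpace F]
    (D : IdealTriangulation F) :
    (∀ μ : D.Edge → ℤ, D.TropicalTriangle μ →
      ∀ C : SimpleClosedCurve F, D.Corresponds μ C → ∀ e : D.Edge, μ e ≤ 3) ∧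
    {c : Quotient (isotopySetoid F) | ∃ C : SimpleClosedCurve F,
      Quotient.mk (isotopySetoid F) C = c ∧
        ∃ μ : D.Edge → ℤ, D.Corresponds μ C ∧ D.TropicalTriangle μ}.Finite := by
  constructor
  · rintro μ hT C ⟨C', -, hN, hμ⟩ ⟨_, s, rfl⟩
    have := IdealTriangulation.ncard_crossings_le_two_of_tropicalTriangle hT hN hμ s
    rw [hμ, IdealTriangulation.ncard_inter_arc]
    omega
  · refine (D.finite_isotopy_classes 2).subset ?_
    rintro _ ⟨C, rfl, μ, ⟨C', hiso, hN, hμ⟩, hT⟩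
    exact ⟨C', Quotient.sound hiso.symm, hN,
      IdealTriangulation.ncard_crossings_le_two_of_tropicalTriangle hT hN hμ⟩
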